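/- Notation. For $f\in L^1(\mathbb R)$ let $\widehat f(\gamma)=\int_{\mathbb R} f(x)e^{-2\pi i x\gamma}\,dx$, extended to a unitary operator on $L^2(\mathbb R)$; for $k\in\mathbb Z$ let $T_kf(x)=f(x-k)$. Functions in $L^2(0,1)$ are identified with their $1$-periodic extensions to $\mathbb R$. For $\phi,\phi_1\in L^2(\mathbb R)$ put $\Phi(\gamma)=\sum_{n\in\mathbb Z}|\widehat\phi(\gamma+n)|^2$ and $\Phi_1(\gamma)=\sum_{n\in\mathbb Z}|\widehat{\phi_1}(\gamma+n)|^2$ for $\gamma\in[0,1]$. A sequence $\{f_k\}_{k\in\mathbb Z}$ in a closed subspace $\mathcal W$ of a Hilbert space $\mathcal H$ is a frame for $\mathcal W$ if there are $0<\alpha\le\beta<\infty$ with $\alpha\|f\|^2\le\sum_k|\langle f,f_k\rangle|^2\le\beta\|f\|^2$ for all $f\in\mathcal W$; its synthesis operator is $T_{\mathcal F}:\ell^2(\mathbb Z)\to\mathcal H$, $T_{\mathcal F}\{c_k\}=\sum_k c_kf_k$, with adjoint $T_{\mathcal F}^*f=\{\langle f,f_k\rangle\}_k$. Let $\mathcal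 W,\mathcal V$ be closed subspaces with $\mathcal H=\mathcal W\oplus\mathcal V^\perp$ (equivalently $\mathcal H=\mathcal V\oplus\mathcal W^\perp$), let $\pi_{\mathcal W\mathcal V^\perp}$ be the projection onto $\mathcal W$ along $\mathcal V^\perp$, and $\pi_{\mathcal V\mathcal W^\perp}$ the projection onto $\mathcal V$ along $\mathcal W^\perp$. For $\varepsilon\ge 0$, sequences $\mathcal F=\{f_k\}$ and $\mathcal G=\{g_k\}$ are $\varepsilon$-approximate oblique dual frames (with respect to $\mathcal W$, $\mathcal V$) if they are frames for $\mathcal W$ and $\mathcal V$ respectively and $$\|\pi_{\mathcal W\mathcal V^\perp}-T_{\mathcal F}T_{\mathcal G}^*\|\le\varepsilon\quad\text{or}\quad\|\pi_{\mathcal V\mathcal W^\perp}-T_{\mathcal G}T_{\mathcal F}^*\|\le\varepsilon .$$ Theorem. Let $\mathcal W,\mathcal V$ be closed subspaces of $L^2(\mathbb R)$ with $L^2(\mathbb R)=\mathcal W\oplus\mathcal V^\perp$, and let $\phi,\phi_1\in L^2(\mathbb R)$ be such that $\{T_k\phi\}_{k\in\mathbb Z}$ and $\{T_k\phi_1\}_{k\in\mathbb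 Z}$ are frames for $\mathcal W$ and $\mathcal V$ respectively. Let $0\le\varepsilon<1$. Let $\psi\in\mathcal V$ satisfy $\widehat\psi=H\widehat{\phi_1}$, where $H\in L^2(0,1)$ is such that $$\left|\overline{H(\gamma)}-\frac{1}{\sum_{n\in\mathbb Z}\widehat\phi(\gamma+n)\overline{\widehat{\phi_1}(\gamma+n)}}\right|\le\frac{\varepsilon}{\sqrt{\Phi(\gamma)\Phi_1(\gamma)}}\qquad\text{for a.e. }\gamma\in\{\gamma\in[0,1]:\Phi(\gamma)\ne 0\}.$$ Then $\{T_k\phi\}_{k\in\mathbb Z}$ and $\{T_k\psi\}_{k\in\mathbb Z}$ are $\varepsilon$-approximate oblique dual frames with respect to $\mathcal W$, $\mathcal V$; in particular, $\{T_k\psi\}_{k\in\mathbb Z}$ is a frame for $\mathcal V$. -/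

import Mathlib

open MeasureTheory ENNReal Set
open scoped FourierTransform lp ComplexConjugate InnerProductSpace

noncomputable section

namespace ApproxOblique

/-! Frames, synthesis and analysis operators and oblique projections in a Hilbert space.
Mathlib's `inner ℂ x y` is linear in `y`, so the scalar product of `f` against `g`, linear in `f`,
is `inner ℂ g f`. -/

section Hilbert

variable {ι E : Type*} [NormedAddCommGroup E] [InnerProductSpace ℂ E]

/-- `{F k}` is a Bessel sequence in the whole space `E`. -/
def IsBessel (F : ι → E) : Prop :=
  ∃ β : ℝ, ∀ f : E, Summable (fun k => ‖inner ℂ (F k) f‖ ^ 2) ∧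
    ∑' k, ‖inner ℂ (F k) f‖ ^ 2 ≤ β * ‖f‖ ^ 2

/-- `{F k} ⊆ W` is a frame for the subspace `W`. -/
structure IsFrameFor (W : Submodule ℂ E) (F : ι → E) : Prop where
  mem : ∀ k, F k ∈ W
  bounds : ∃ α β : ℝ, 0 < α ∧ α ≤ β ∧ ∀ f ∈ W,
    Summable (fun k => ‖inner ℂ (F k) f‖ ^ 2) ∧
      α * ‖f‖ ^ 2 ≤ ∑' k, ‖inner ℂ (F k) f‖ ^ 2 ∧
      ∑' k, ‖inner ℂ (F k) f‖ ^ 2 ≤ β * ‖f‖ ^ 2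

/-- A frame for a closed subspace is a Bessel sequence in the whole space. -/
theorem IsFrameFor.isBessel [CompleteSpace E] {W : Submodule ℂ E} {F : ι → E}
    (hF : IsFrameFor W F) (hW : IsClosed (W : Set E)) : IsBessel F := by
  obtain ⟨α, β, hα, hαβ, h⟩ := hF.bounds
  have : CompleteSpace W := hW.completeSpace_coe
  refine ⟨β, fun f => ?_⟩
  have key : ∀ k, inner ℂ (F k) f = inner ℂ (F k) (W.starProjection f) := by
    intro k
    have h1 : inner ℂ (F k) (f - W.starProjection f) = 0 :=
      (Submodule.mem_orthogonal W _).1 (W.sub_starProjection_mem_orthogonal f) _ (hF.mem k)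
    rw [inner_sub_right] at h1
    exact sub_eq_zero.1 h1
  obtain ⟨hs, -, hb⟩ := h (W.starProjection f) (W.starProjection_apply_mem f)
  simp only [key]
  refine ⟨hs, hb.trans ?_⟩
  have : ‖W.starProjection f‖ ≤ ‖f‖ := W.norm_starProjection_apply_le f
  have hβ : 0 ≤ β := hα.le.trans hαβ
  gcongr

theorem IsBessel.memℓp {F : ι → E} (hF : IsBessel F) (f : E) :
    Memℓp (fun k => inner ℂ (F k) f) 2 := by
  obtain ⟨β, h⟩ := hF
  refine memℓp_gen ?_
  simpa using (h f).1

/-- The analysis operator `f ↦ (⟨f, F k⟩)ₖ`, from `E` to `ℓ²(ι)`, of a Bessel sequence. -/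
def analysisOp (F : ι → E) (hF : IsBessel F) : E →L[ℂ] ℓ²(ι, ℂ) :=
  LinearMap.mkContinuousOfExistsBound
    { toFun := fun f => (⟨fun k => inner ℂ (F k) f, hF.memℓp f⟩ : ℓ²(ι, ℂ))
      map_add' := fun f g => by ext k; exact inner_add_right _ _ _
      map_smul' := fun c f => by ext k; exact inner_smul_right _ _ _ }
    (by
      obtain ⟨β, h⟩ := hF
      refine ⟨Real.sqrt |β|, fun f => ?_⟩
      refine abs_le_of_sq_le_sq' ?_ (by positivity) |>.2
      rw [mul_pow, Real.sq_sqrt (abs_nonneg β)]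
      have e := lp.norm_rpow_eq_tsum (p := 2) (by norm_num)
        (⟨fun k => inner ℂ (F k) f, IsBessel.memℓp ⟨β, h⟩ f⟩ : ℓ²(ι, ℂ))
      simp only [ENNReal.toReal_ofNat, Real.rpow_ofNat] at e
      refine (e.trans_le (h f).2).trans ?_
      gcongr
      exact le_abs_self β)

@[simp] theorem analysisOp_apply (F : ι → E) (hF : IsBessel F) (f : E) (k : ι) :
    analysisOp F hF f k = inner ℂ (F k) f := rfl

variable [CompleteSpace E]

/-- The synthesis operator `c ↦ ∑ₖ c k • F k`, from `ℓ²(ι)` to `E`, of a Bessel sequence (see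
`hasSum_synthesisOp`), constructed as the adjoint of the analysis operator. -/
def synthesisOp (F : ι → E) (hF : IsBessel F) : ℓ²(ι, ℂ) →L[ℂ] E :=
  ContinuousLinearMap.adjoint (analysisOp F hF)

theorem hasSum_synthesisOp (F : ι → E) (hF : IsBessel F) (c : ℓ²(ι, ℂ)) :
    HasSum (fun k => c k • F k) (synthesisOp F hF c) := by
  classical
  have h1 := (lp.hasSum_single (p := 2) (by norm_num) c).mapL (synthesisOp F hF)
  convert h1 using 2 with k
  refine ext_inner_right ℂ fun f => ?_
  rw [synthesisOp, ContinuousLinearMap.adjoint_inner_left, lp.inner_single_left, inner_smul_left]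
  simp [mul_comm]

/-- If `E = W ⊕ Vᗮ` with `W`, `V` closed, then also `E = V ⊕ Wᗮ`. -/
theorem isCompl_swap {W V : Submodule ℂ E} (hW : IsClosed (W : Set E))
    (hV : IsClosed (V : Set E)) (h : IsCompl W Vᗮ) : IsCompl V Wᗮ := by
  have ht : W.IsTopCompl Vᗮ := Submodule.IsCompl.isTopCompl_of_isClosed h hW V.isClosed_orthogonal
  have : CompleteSpace V := hV.completeSpace_coe
  set P : E →L[ℂ] E := W.projectionL Vᗮ ht with hP
  have hPi : IsIdempotentElem P := Submodule.isIdempotentElem_projectionL ht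
  have hPr : P.range = W := Submodule.range_projectionL ht
  have hPk : P.ker = Vᗮ := Submodule.ker_projectionL ht
  have hQi : IsIdempotentElem (ContinuousLinearMap.adjoint P) := by
    have := congrArg ContinuousLinearMap.adjoint hPi
    rwa [ContinuousLinearMap.mul_def, ContinuousLinearMap.adjoint_comp] at this
  have hc := (ContinuousLinearMap.IsIdempotentElem.isTopCompl hQi)
  have hQk : (ContinuousLinearMap.adjoint P).ker = Wᗮ := by
    rw [← ContinuousLinearMap.orthogonal_range, hPr]
  have hQr : (ContinuousLinearMap.adjoint P).range = V := by
    have h1 := ContinuousLinearMap.orthogonal_ker P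
    rw [hPk, V.orthogonal_orthogonal] at h1
    rw [h1]
    have h2 : IsClosed ((ContinuousLinearMap.adjoint P).range : Set E) := hc.isClosed
    exact (IsClosed.submodule_topologicalClosure_eq h2).symm
  rw [hQk, hQr] at hc
  exact hc.isCompl

/-- The oblique projection onto `W` along `Vᗮ`, when `E = W ⊕ Vᗮ` and `W` is closed. -/
def obliqueProj (W V : Submodule ℂ E) (hW : IsClosed (W : Set E)) (h : IsCompl W Vᗮ) :
    E →L[ℂ] E :=
  W.projectionL Vᗮ (Submodule.IsCompl.isTopCompl_of_isClosed h hW V.isClosed_orthogonal)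

/-- For closed subspaces with `E = W ⊕ Vᗮ`: `F` and `G` are frames for `W` and `V`, with
`‖π_{W Vᗮ} - T_F T_G^*‖ ≤ ε` or `‖π_{V Wᗮ} - T_G T_F^*‖ ≤ ε`. -/
def IsApproxObliqueDual (ε : ℝ) (W V : Submodule ℂ E) (hW : IsClosed (W : Set E))
    (hV : IsClosed (V : Set E)) (h : IsCompl W Vᗮ) (F G : ι → E) : Prop :=
  ∃ (hF : IsFrameFor W F) (hG : IsFrameFor V G),
    ‖obliqueProj W V hW h -
      synthesisOp F (hF.isBessel hW) ∘L
        ContinuousLinearMap.adjoint (synthesisOp G (hG.isBessel hV))‖ ≤ ε ∨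
    ‖obliqueProj V W hV (isCompl_swap hW hV h) -
      synthesisOp G (hG.isBessel hV) ∘L
        ContinuousLinearMap.adjoint (synthesisOp F (hF.isBessel hW))‖ ≤ ε

end Hilbert

/-! Shift-invariant objects in `L²(ℝ)`. -/

/-- The complex Hilbert space `L²(ℝ)`. -/
abbrev L2R : Type := Lp ℂ 2 (volume : Measure ℝ)

/-- The translation operator `T_k f (x) = f (x - k)` on `L²(ℝ)`. -/
def translate (k : ℤ) (f : L2R) : L2R :=
  Lp.compMeasurePreserving (fun x : ℝ => x - (k : ℝ)) (measurePreserving_sub_right volume (k : ℝ)) f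

theorem translate_coeFn (k : ℤ) (f : L2R) :
    translate k f =ᵐ[volume] fun x => f (x - (k : ℝ)) :=
  Lp.coeFn_compMeasurePreserving f _

/-- `γ ↦ ∑ₙ |φ̂(γ + n)|²`. -/
def periodization (φ : L2R) (γ : ℝ) : ℝ := ∑' n : ℤ, ‖(𝓕 φ : L2R) (γ + n)‖ ^ 2

/-- `γ ↦ ∑ₙ φ̂(γ + n) conj (φ̂₁(γ + n))`. -/
def bracket (φ φ₁ : L2R) (γ : ℝ) : ℂ :=
  ∑' n : ℤ, (𝓕 φ : L2R) (γ + n) * conj ((𝓕 φ₁ : L2R) (γ + n))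

end ApproxOblique

end

/-! Write `[f, g]` for the bracket product of the Fourier transforms of `f` and `g`. By Plancherel
and periodization the scalar product of `f` with the `k`-th translate of `φ` is a Fourier
coefficient of `[f, φ]` (`inner_translate`), so Parseval turns questions about systems of translates
into pointwise questions about brackets on `(0, 1]`.

Since `ψ̂ = H φ̂₁`, the mixed frame operator has the weak form `∫ conj H [f, φ₁] conj [g, φ]`, while
the oblique projection has the weak form `∫ [f, φ₁] / [φ, φ₁] conj [g, φ]` (`inner_obliqueProj`). In
the difference, Cauchy–Schwarz bounds `|[f, φ₁]| |[g, φ]|` by `√(Φ Φ₁)` times the square roots of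
the periodizations of `f` and `g`. The hypothesis on `H` cancels `√(Φ Φ₁)` and leaves `ε ‖f‖ ‖g‖`
(`norm_obliqueProj_sub_le`).

Division by `[φ, φ₁]` is controlled by `c max(Φ, Φ₁) ≤ |[φ, φ₁]|²`, which comes from the oblique
decomposition (`exists_mul_normSqSum_le`); this also makes the translates of `ψ` Bessel. As `ε < 1`
and the projection does not shrink vectors of `V`, the lower frame bound follows
(`isFrameFor_of_norm_obliqueProj_sub_le`). -/

noncomputable section

namespace ApproxOblique

/-! Periodization of functions on the real line. -/

section Periodization

/-- Lebesgue measure on `(0, 1]`. -/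
abbrev unitVolume : Measure ℝ := volume.restrict (Ioc (0 : ℝ) 1)

theorem ae_forall_int {p : ℝ → Prop} (h : ∀ᵐ x, p x) : ∀ᵐ x : ℝ, ∀ n : ℤ, p (x + n) :=
  ae_all_iff.2 fun n =>
    (measurePreserving_add_right volume (n : ℝ)).quasiMeasurePreserving.ae h

/-- A property invariant under integer translations holds a.e. if it holds a.e. on `(0, 1]`. -/
theorem ae_of_ae_unitVolume {p : ℝ → Prop} (hp : ∀ (x : ℝ) (n : ℤ), p (x + n) → p x)
    (h : ∀ᵐ x ∂unitVolume, p x) : ∀ᵐ x : ℝ, p x := by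
  have h' := ae_forall_int ((ae_restrict_iff' measurableSet_Ioc).1 h)
  filter_upwards [h'] with x hx
  obtain ⟨n, hn, -⟩ := existsUnique_add_zsmul_mem_Ioc (zero_lt_one (α := ℝ)) x 0
  rw [zsmul_one, zero_add] at hn
  exact hp x n (hx n hn)

theorem lintegral_eq_lintegral_tsum {g : ℝ → ℝ≥0∞} (hg : AEMeasurable g) :
    ∫⁻ x, g x = ∫⁻ x, ∑' n : ℤ, g (x + n) ∂unitVolume := by
  rw [lintegral_tsum]
  · have hU : (⋃ n : ℤ, Ioc (n : ℝ) (n + 1)) = univ := iUnion_Ioc_intCast ℝ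
    rw [← setLIntegral_univ, ← hU, lintegral_iUnion (fun n => measurableSet_Ioc)]
    · refine tsum_congr fun n => ?_
      have := (measurePreserving_add_right volume (n : ℝ)).setLIntegral_comp_preimage_emb
        (measurableEmbedding_addRight (n : ℝ)) g (Ioc (n : ℝ) (n + 1))
      rw [← this]
      simp
    · exact pairwise_disjoint_Ioc_intCast ℝ
  · intro n
    exact (hg.comp_quasiMeasurePreserving
      (measurePreserving_add_right volume (n : ℝ)).quasiMeasurePreserving).mono_measure
        Measure.restrict_le_self

variable {E : Type*} [NormedAddCommGroup E]

theorem tsum_lintegral_enorm_ne_top {h : ℝ → E} (hh : Integrable h) :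
    ∑' n : ℤ, ∫⁻ x, ‖h (x + n)‖ₑ ∂unitVolume ≠ ∞ := by
  rw [← lintegral_tsum, ← lintegral_eq_lintegral_tsum hh.1.enorm]
  · exact hh.2.ne
  · intro n
    exact (hh.comp_add_right (n : ℝ)).1.enorm.mono_measure Measure.restrict_le_self

/-- By Tonelli the sum of the norms has finite integral over `(0, 1]`, hence is finite a.e. there;
summability is invariant under integer shifts, so it passes to the line. -/
theorem ae_summable_norm_periodization {h : ℝ → E} (hh : Integrable h) :
    ∀ᵐ x : ℝ, Summable fun n : ℤ => ‖h (x + n)‖ := by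
  refine ae_of_ae_unitVolume (fun x m hx => ?_) ?_
  · rw [← (Equiv.addLeft m).summable_iff]
    simpa [Function.comp_def, add_assoc] using hx
  · have h1 : ∀ᵐ x ∂unitVolume, ∑' n : ℤ, ‖h (x + n)‖ₑ < ∞ := by
      have hm : ∀ n : ℤ, AEMeasurable (fun x => ‖h (x + n)‖ₑ) unitVolume := fun n =>
        (hh.comp_add_right (n : ℝ)).1.enorm.mono_measure Measure.restrict_le_self
      refine ae_lt_top' (AEMeasurable.tsum hm) ?_
      rw [lintegral_tsum hm]
      exact tsum_lintegral_enorm_ne_top hh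
    filter_upwards [h1] with x hx
    simpa using ENNReal.summable_toReal hx.ne

theorem integrable_periodization [NormedSpace ℝ E] [CompleteSpace E] {h : ℝ → E}
    (hh : Integrable h) :
    Integrable (fun x => ∑' n : ℤ, h (x + n)) unitVolume ∧
      ∫ x, ∑' n : ℤ, h (x + n) ∂unitVolume = ∫ x, h x := by
  have hi : ∀ n : ℤ, Integrable (fun x => h (x + n)) unitVolume := fun n =>
    (hh.comp_add_right (n : ℝ)).mono_measure Measure.restrict_le_self
  have hne := tsum_lintegral_enorm_ne_top hh
  have hs := ae_restrict_of_ae (s := Ioc (0 : ℝ) 1) (ae_summable_norm_periodization hh)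
  have hU : (⋃ n : ℤ, Ioc (n : ℝ) (n + 1)) = univ := iUnion_Ioc_intCast ℝ
  refine ⟨⟨?_, ?_⟩, ?_⟩
  · refine aestronglyMeasurable_of_tendsto_ae Filter.atTop
      (f := fun (s : Finset ℤ) x => ∑ n ∈ s, h (x + n))
      (fun s => Finset.aestronglyMeasurable_fun_sum s fun n _ => (hi n).1) ?_
    filter_upwards [hs] with x hx
    exact hx.of_norm.hasSum
  · refine lt_of_le_of_lt (lintegral_mono_ae ?_)
      (lt_top_iff_ne_top.2 ((lintegral_tsum fun n => (hi n).1.enorm).trans_ne hne))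
    filter_upwards [hs] with x hx
    exact enorm_tsum_le_tsum_enorm
  · rw [integral_tsum (fun n => (hi n).1) hne, ← setIntegral_univ (f := h), ← hU,
      integral_iUnion (fun n => measurableSet_Ioc) (pairwise_disjoint_Ioc_intCast ℝ)
        hh.integrableOn]
    refine tsum_congr fun n => ?_
    have := (measurePreserving_add_right volume (n : ℝ)).setIntegral_preimage_emb
      (measurableEmbedding_addRight (n : ℝ)) h (Ioc (n : ℝ) (n + 1))
    rw [← this]
    simp

end Periodization

end ApproxOblique

end
noncomputable section

namespace ApproxOblique

/-! The bracket product of two functions on the real line. -/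

section Bracket

/-- `γ ↦ ∑ₙ |a (γ + n)|²`. -/
def normSqSum (a : ℝ → ℂ) (γ : ℝ) : ℝ := ∑' n : ℤ, ‖a (γ + n)‖ ^ 2

/-- `γ ↦ ∑ₙ a (γ + n) conj (b (γ + n))`. -/
def bracketSum (a b : ℝ → ℂ) (γ : ℝ) : ℂ := ∑' n : ℤ, a (γ + n) * conj (b (γ + n))

variable {a b a' b' m : ℝ → ℂ}

theorem normSqSum_nonneg (a : ℝ → ℂ) (γ : ℝ) : 0 ≤ normSqSum a γ :=
  tsum_nonneg fun _ => by positivity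

theorem measurable_normSqSum (ha : Measurable a) : Measurable (normSqSum a) :=
  Measurable.tsum fun n => ((ha.comp (measurable_add_const (n : ℝ))).norm.pow_const 2)

theorem measurable_bracketSum (ha : Measurable a) (hb : Measurable b) :
    Measurable (bracketSum a b) :=
  Measurable.tsum fun n => (ha.comp (measurable_add_const (n : ℝ))).mul
    (Complex.continuous_conj.measurable.comp (hb.comp (measurable_add_const (n : ℝ))))

theorem periodic_normSqSum (a : ℝ → ℂ) : Function.Periodic (normSqSum a) 1 := fun γ => by
  rw [normSqSum, normSqSum, ← (Equiv.addLeft (1 : ℤ)).tsum_eq fun n : ℤ => ‖a (γ + n)‖ ^ 2]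
  simp [add_assoc]

theorem periodic_bracketSum (a b : ℝ → ℂ) : Function.Periodic (bracketSum a b) 1 := fun γ => by
  rw [bracketSum, bracketSum,
    ← (Equiv.addLeft (1 : ℤ)).tsum_eq fun n : ℤ => a (γ + n) * conj (b (γ + n))]
  simp [add_assoc]

theorem _root_.Function.Periodic.apply_add_intCast {α : Type*} {f : ℝ → α}
    (hf : Function.Periodic f 1) (x : ℝ) (n : ℤ) : f (x + n) = f x := by
  simpa using hf.int_mul n x

theorem bracketSum_mul_left (hm : Function.Periodic m 1) (γ : ℝ) :
    bracketSum (fun x => m x * a x) b γ = m γ * bracketSum a b γ := by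
  simp only [bracketSum, hm.apply_add_intCast, mul_assoc, tsum_mul_left]

theorem bracketSum_mul_right (hm : Function.Periodic m 1) (γ : ℝ) :
    bracketSum a (fun x => m x * b x) γ = conj (m γ) * bracketSum a b γ := by
  simp only [bracketSum, hm.apply_add_intCast, map_mul, mul_left_comm _ (conj (m γ)),
    tsum_mul_left]

theorem normSqSum_mul (hm : Function.Periodic m 1) (γ : ℝ) :
    normSqSum (fun x => m x * a x) γ = ‖m γ‖ ^ 2 * normSqSum a γ := by
  simp only [normSqSum, hm.apply_add_intCast, norm_mul, mul_pow, tsum_mul_left]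

theorem conj_bracketSum (a b : ℝ → ℂ) (γ : ℝ) :
    conj (bracketSum a b γ) = bracketSum b a γ := by
  simp only [bracketSum, Complex.conj_tsum, map_mul, Complex.conj_conj, mul_comm]

/-- Only countably many translates are involved, so the exceptional sets have null union. -/
theorem bracketSum_congr (ha : a =ᵐ[volume] a') (hb : b =ᵐ[volume] b') :
    bracketSum a b =ᵐ[volume] bracketSum a' b' := by
  filter_upwards [ae_forall_int ha, ae_forall_int hb] with γ h1 h2
  simp only [bracketSum, h1, h2]

theorem normSqSum_congr (ha : a =ᵐ[volume] a') : normSqSum a =ᵐ[volume] normSqSum a' := by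
  filter_upwards [ae_forall_int ha] with γ h1
  simp only [normSqSum, h1]

theorem ae_summable_norm_sq (ha : MemLp a 2) :
    ∀ᵐ γ : ℝ, Summable fun n : ℤ => ‖a (γ + n)‖ ^ 2 := by
  filter_upwards [ae_summable_norm_periodization (ha.integrable_norm_pow (p := 2) two_ne_zero)]
    with γ h
  simpa using h

theorem integrable_normSqSum (ha : MemLp a 2) :
    Integrable (normSqSum a) unitVolume ∧
      ∫ γ, normSqSum a γ ∂unitVolume = ∫ x, ‖a x‖ ^ 2 :=
  integrable_periodization (h := fun x => ‖a x‖ ^ 2) (ha.integrable_norm_pow (p := 2) two_ne_zero)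

theorem integrable_mul_conj (ha : MemLp a 2) (hb : MemLp b 2) :
    Integrable fun x => a x * conj (b x) := ha.integrable_mul hb.star

theorem integrable_bracketSum (ha : MemLp a 2) (hb : MemLp b 2) :
    Integrable (bracketSum a b) unitVolume ∧
      ∫ γ, bracketSum a b γ ∂unitVolume = ∫ x, a x * conj (b x) :=
  integrable_periodization (integrable_mul_conj ha hb)

theorem norm_tsum_mul_conj_le {x y : ℤ → ℂ} (hx : Summable fun n => ‖x n‖ ^ 2)
    (hy : Summable fun n => ‖y n‖ ^ 2) :
    ‖∑' n, x n * conj (y n)‖ ≤ √(∑' n, ‖x n‖ ^ 2) * √(∑' n, ‖y n‖ ^ 2) := by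
  have h := Real.summable_and_inner_le_Lp_mul_Lq_tsum_of_nonneg (p := 2) (q := 2)
    Real.HolderConjugate.two_two
    (fun n => norm_nonneg (x n)) (fun n => norm_nonneg (y n)) (by simpa using hx)
    (by simpa using hy)
  simp only [Real.rpow_ofNat, ← Real.sqrt_eq_rpow] at h
  refine le_trans ?_ h.2
  have := norm_tsum_le_tsum_norm (f := fun n => x n * conj (y n)) (by simpa using h.1)
  simpa using this

theorem norm_bracketSum_le (ha : MemLp a 2) (hb : MemLp b 2) :
    ∀ᵐ γ : ℝ, ‖bracketSum a b γ‖ ≤ √(normSqSum a γ) * √(normSqSum b γ) := by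
  filter_upwards [ae_summable_norm_sq ha, ae_summable_norm_sq hb] with γ h1 h2
  exact norm_tsum_mul_conj_le h1 h2

theorem bracketSum_sub_left (ha : MemLp a 2) (ha' : MemLp a' 2) (hb : MemLp b 2) :
    ∀ᵐ γ : ℝ, bracketSum (fun x => a x - a' x) b γ = bracketSum a b γ - bracketSum a' b γ := by
  filter_upwards [ae_summable_norm_periodization (integrable_mul_conj ha hb),
    ae_summable_norm_periodization (integrable_mul_conj ha' hb)] with γ h1 h2
  simp only [bracketSum, sub_mul]
  exact h1.of_norm.tsum_sub h2.of_norm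

/-- The product with a periodic `m` is square-integrable on the real line if `|m|² ∑ₙ |a(· + n)|²`
is integrable on `(0, 1]`. -/
theorem memLp_periodic_mul (hm : Function.Periodic m 1) (hmm : Measurable m) (ha : MemLp a 2)
    (h : Integrable (fun γ => ‖m γ‖ ^ 2 * normSqSum a γ) unitVolume) :
    MemLp (fun γ => m γ * a γ) 2 := by
  have hmeas : AEStronglyMeasurable (fun γ => m γ * a γ) volume := hmm.aestronglyMeasurable.mul ha.1
  refine (memLp_two_iff_integrable_sq_norm hmeas).2 ⟨hmeas.norm.pow 2, ?_⟩
  rw [hasFiniteIntegral_iff_ofReal (.of_forall fun γ => by positivity),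
    lintegral_eq_lintegral_tsum (g := fun γ => ENNReal.ofReal (‖m γ * a γ‖ ^ 2))
      (hmeas.norm.pow 2).aemeasurable.ennreal_ofReal]
  refine lt_of_le_of_lt (lintegral_mono_ae ?_)
    ((hasFiniteIntegral_iff_ofReal (.of_forall fun γ =>
      mul_nonneg (by positivity) (normSqSum_nonneg a γ))).1 h.2)
  filter_upwards [ae_restrict_of_ae (ae_summable_norm_sq ha)] with γ hγ
  rw [← ENNReal.ofReal_tsum_of_nonneg (fun n => by positivity)]
  · exact (congrArg ENNReal.ofReal (normSqSum_mul hm γ)).le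
  · simpa only [norm_mul, mul_pow, hm.apply_add_intCast] using hγ.mul_left (‖m γ‖ ^ 2)

end Bracket

end ApproxOblique

end
noncomputable section

namespace ApproxOblique

/-! Fourier coefficients of functions on `(0, 1]`. -/

section FourierCoefficients

/-- The integral of `e^{2πikγ} u(γ)` over `(0, 1]`. -/
def unitCoeff (u : ℝ → ℂ) (k : ℤ) : ℂ :=
  ∫ γ : ℝ, fourier k (γ : UnitAddCircle) * u γ ∂unitVolume

variable {u v : ℝ → ℂ}

theorem unitCoeff_congr (h : u =ᵐ[unitVolume] v) : unitCoeff u = unitCoeff v := by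
  funext k
  refine integral_congr_ae ?_
  filter_upwards [h] with γ hγ
  rw [hγ]

theorem norm_fourier_coe (k : ℤ) (x : UnitAddCircle) : ‖fourier k x‖ = 1 := by
  rw [fourier_apply, Circle.norm_coe]

theorem integrable_continuousMap_mul (hu : Integrable u unitVolume) (F : C(UnitAddCircle, ℂ)) :
    Integrable (fun γ : ℝ => F (γ : UnitAddCircle) * u γ) unitVolume := by
  refine hu.bdd_mul (c := ‖F‖) ?_ (.of_forall fun γ => F.norm_coe_le_norm _)
  exact (F.continuous.comp (AddCircle.continuous_mk' 1)).aestronglyMeasurable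

theorem unitCoeff_sub (hu : Integrable u unitVolume) (hv : Integrable v unitVolume) (k : ℤ) :
    unitCoeff (fun γ => u γ - v γ) k = unitCoeff u k - unitCoeff v k := by
  simp only [unitCoeff, mul_sub]
  exact integral_sub (integrable_continuousMap_mul hu _) (integrable_continuousMap_mul hv _)

/-- The sign appears because `fourierCoeff` integrates against the conjugate character. -/
theorem unitCoeff_eq_fourierCoeff (u : ℝ → ℂ) (k : ℤ) :
    unitCoeff u k = fourierCoeff (AddCircle.liftIoc 1 0 u) (-k) := by
  rw [fourierCoeff_eq_intervalIntegral _ _ 0, unitCoeff, zero_add, one_div, inv_one, one_smul,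
    intervalIntegral.integral_of_le zero_le_one]
  refine setIntegral_congr_fun measurableSet_Ioc fun γ hγ => ?_
  rw [AddCircle.liftIoc_coe_apply (by simpa using hγ), neg_neg, smul_eq_mul]

theorem memLp_liftIoc (hu : MemLp u 2 unitVolume) :
    MemLp (AddCircle.liftIoc 1 0 u) 2 (AddCircle.haarAddCircle (T := 1)) := by
  have : MemLp u 2 (volume.restrict (Ioc (0 : ℝ) (0 + 1))) := by simpa using hu
  exact this.memLp_liftIoc.haarAddCircle

/-- Parseval's identity for the scalar product of two functions on `(0, 1]`. -/
theorem hasSum_conj_unitCoeff_mul (hu : MemLp u 2 unitVolume) (hv : MemLp v 2 unitVolume) :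
    HasSum (fun k => conj (unitCoeff v k) * unitCoeff u k) (∫ γ, conj (v γ) * u γ ∂unitVolume) := by
  have hU := memLp_liftIoc hu
  have hV := memLp_liftIoc hv
  have h := fourierBasis.hasSum_inner_mul_inner hV.toLp hU.toLp
  rw [← (Equiv.neg ℤ).hasSum_iff] at h
  convert! h using 1
  · funext k
    simp only [Function.comp_apply, Equiv.neg_apply]
    rw [← inner_conj_symm, ← HilbertBasis.repr_apply_apply, ← HilbertBasis.repr_apply_apply,
      fourierBasis_repr, fourierBasis_repr, fourierCoeff_congr_ae hU.coeFn_toLp,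
      fourierCoeff_congr_ae hV.coeFn_toLp, unitCoeff_eq_fourierCoeff, unitCoeff_eq_fourierCoeff]
  · rw [L2.inner_def]
    have : ∫ x, inner ℂ ((hV.toLp : UnitAddCircle → ℂ) x) ((hU.toLp : UnitAddCircle → ℂ) x)
        ∂(AddCircle.haarAddCircle (T := 1)) =
        ∫ x, conj (AddCircle.liftIoc 1 0 v x) * AddCircle.liftIoc 1 0 u x
          ∂(AddCircle.haarAddCircle (T := 1)) := by
      refine integral_congr_ae ?_
      filter_upwards [hU.coeFn_toLp, hV.coeFn_toLp] with x h1 h2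
      rw [h1, h2, RCLike.inner_apply, mul_comm]
    rw [this, AddCircle.integral_haarAddCircle, inv_one, one_smul,
      ← UnitAddCircle.integral_preimage 0, zero_add]
    refine setIntegral_congr_fun measurableSet_Ioc fun γ hγ => ?_
    have hγ' : γ ∈ Ioc (0 : ℝ) (0 + 1) := by simpa using hγ
    simp only [AddCircle.liftIoc_coe_apply hγ']

theorem hasSum_norm_unitCoeff_sq (hu : MemLp u 2 unitVolume) :
    HasSum (fun k => ‖unitCoeff u k‖ ^ 2) (∫ γ, ‖u γ‖ ^ 2 ∂unitVolume) := by
  have h := hasSum_conj_unitCoeff_mul hu hu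
  simp only [Complex.conj_mul'] at h
  have h2 : ∫ γ, ((‖u γ‖ : ℂ) ^ 2) ∂unitVolume = ((∫ γ, ‖u γ‖ ^ 2 ∂unitVolume : ℝ) : ℂ) := by
    exact_mod_cast integral_ofReal (𝕜 := ℂ) (f := fun γ => ‖u γ‖ ^ (2 : ℕ))
  rw [h2] at h
  exact_mod_cast h

/-- An integrable function on `(0, 1]` is determined by its Fourier coefficients. -/
theorem ae_eq_zero_of_unitCoeff_eq_zero (hu : Integrable u unitVolume)
    (h : ∀ k, unitCoeff u k = 0) : u =ᵐ[unitVolume] 0 := by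
  let Λ : C(UnitAddCircle, ℂ) →L[ℂ] ℂ := LinearMap.mkContinuous
    { toFun := fun F => ∫ γ : ℝ, F (γ : UnitAddCircle) * u γ ∂unitVolume
      map_add' := fun F G => by
        simp only [ContinuousMap.add_apply, add_mul]
        exact integral_add (integrable_continuousMap_mul hu _) (integrable_continuousMap_mul hu _)
      map_smul' := fun c F => by
        simp only [ContinuousMap.smul_apply, smul_eq_mul, mul_assoc, RingHom.id_apply,
          integral_const_mul] }
    (∫ γ, ‖u γ‖ ∂unitVolume) (fun F => by
      rw [mul_comm, ← integral_const_mul]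
      refine norm_integral_le_of_norm_le (hu.norm.const_mul _) (.of_forall fun γ => ?_)
      rw [norm_mul]
      gcongr
      exact F.norm_coe_le_norm _)
  -- The functional is continuous on `C(UnitAddCircle, ℂ)` and kills every character; trigonometric
  -- polynomials are dense.
  have hΛ : Λ = 0 := by
    refine ContinuousLinearMap.ext_on (s := range (fourier (T := 1))) ?_ ?_
    · rw [Submodule.dense_iff_topologicalClosure_eq_top]
      exact span_fourier_closure_eq_top
    · rintro _ ⟨k, rfl⟩
      exact h k
  -- Test functions supported in the open interval vanish at both ends, so they descend to
  -- continuous functions on the circle, where `Λ = 0` applies.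
  have key : ∀ᵐ x : ℝ, x ∈ Ioo (0 : ℝ) 1 → u x = 0 := by
    refine isOpen_Ioo.ae_eq_zero_of_integral_contDiff_smul_eq_zero
      (IntegrableOn.locallyIntegrableOn (IntegrableOn.mono_set hu Ioo_subset_Ioc_self)) fun g hg _ hs => ?_
    have hg0 : ∀ x ∉ Ioo (0 : ℝ) 1, g x = 0 := fun x hx =>
      image_eq_zero_of_notMem_tsupport fun hx' => hx (hs hx')
    have hc : Continuous (AddCircle.liftIoc 1 0 fun x => (g x : ℂ)) := by
      refine AddCircle.liftIoc_zero_continuous ?_ ?_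
      · simp [hg0]
      · exact (Complex.continuous_ofReal.comp hg.continuous).continuousOn
    have h1 : ∫ γ : ℝ, AddCircle.liftIoc 1 0 (fun x => (g x : ℂ)) (γ : UnitAddCircle) * u γ
        ∂unitVolume = 0 := congrArg (fun L => L ⟨_, hc⟩) hΛ
    rw [← setIntegral_eq_integral_of_forall_compl_eq_zero (s := Ioc (0 : ℝ) 1), ← h1]
    · refine setIntegral_congr_fun measurableSet_Ioc fun γ hγ => ?_
      have hγ' : γ ∈ Ioc (0 : ℝ) (0 + 1) := by simpa using hγ
      simp only [AddCircle.liftIoc_coe_apply hγ', Complex.real_smul]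
    · intro x hx
      rw [hg0 x fun hx' => hx (Ioo_subset_Ioc_self hx'), zero_smul]
  change ∀ᵐ x ∂(volume.restrict (Ioc (0 : ℝ) 1)), u x = 0
  rw [← Measure.restrict_congr_set (Ioo_ae_eq_Ioc (a := (0 : ℝ)) (b := 1)),
    ae_restrict_iff' measurableSet_Ioo]
  exact key

/-- An integrable function on `(0, 1]` with square-summable Fourier coefficients is
square-integrable. -/
theorem memLp_two_of_summable_unitCoeff (hu : Integrable u unitVolume)
    (h : Summable fun k => ‖unitCoeff u k‖ ^ 2) : MemLp u 2 unitVolume := by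
  have hc : Memℓp (fun k => unitCoeff u (-k)) 2 := by
    refine memℓp_gen ?_
    rw [← (Equiv.neg ℤ).summable_iff]
    simpa [Function.comp_def] using h
  -- Riesz–Fischer: `w` is the square-integrable function with the coefficients of `u`; uniqueness
  -- of coefficients then identifies the two.
  let w := fourierBasis (T := 1).repr.symm ⟨_, hc⟩
  have hw : MemLp (fun γ : ℝ => w (γ : UnitAddCircle)) 2 unitVolume := by
    have h1 : MemLp w 2 (volume : Measure UnitAddCircle) :=
      memLp_haarAddCircle_iff.1 (Lp.memLp w)
    have h2 := UnitAddCircle.measurePreserving_mk 0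
    rw [zero_add] at h2
    exact h1.comp_measurePreserving h2
  have hwi : Integrable (fun γ : ℝ => w (γ : UnitAddCircle)) unitVolume :=
    hw.integrable one_le_two
  have hcoef : ∀ k, unitCoeff (fun γ : ℝ => w (γ : UnitAddCircle)) k = unitCoeff u k := by
    intro k
    have h1 : fourierBasis.repr w (-k) = unitCoeff u k := by
      simp [w]
    rw [← h1, fourierBasis_repr, fourierCoeff_eq_intervalIntegral _ _ 0, zero_add, one_div,
      inv_one, one_smul, intervalIntegral.integral_of_le zero_le_one, neg_neg]
    rfl
  have h0 : (fun γ => u γ - w (γ : UnitAddCircle)) =ᵐ[unitVolume] 0 := by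
    refine ae_eq_zero_of_unitCoeff_eq_zero (hu.sub hwi) fun k => ?_
    rw [unitCoeff_sub hu hwi, hcoef, sub_self]
  refine hw.ae_eq ?_
  filter_upwards [h0] with γ hγ
  exact (sub_eq_zero.1 hγ).symm

end FourierCoefficients

end ApproxOblique

end
noncomputable section

namespace ApproxOblique

/-! Translation and the Fourier transform on `L²(ℝ)`. -/

section FourierTranslate

theorem memLp_modulate (k : ℤ) {f : ℝ → ℂ} (hf : MemLp f 2) :
    MemLp (fun γ : ℝ => fourier k (γ : UnitAddCircle) * f γ) 2 := by
  refine hf.of_le ?_ (.of_forall fun γ => by rw [norm_mul, norm_fourier_coe, one_mul])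
  exact (((fourier (T := 1) k).continuous.comp
    (AddCircle.continuous_mk' 1)).aestronglyMeasurable).mul hf.1

/-- Multiplication by `γ ↦ e^{2πikγ}`, an isometry of `L²(ℝ)`. -/
def modulate (k : ℤ) : L2R →ₗᵢ[ℂ] L2R where
  toFun f := (memLp_modulate k (Lp.memLp f)).toLp
  map_add' f g := by
    refine Lp.ext ?_
    filter_upwards [(memLp_modulate k (Lp.memLp (f + g))).coeFn_toLp,
      Lp.coeFn_add (memLp_modulate k (Lp.memLp f)).toLp (memLp_modulate k (Lp.memLp g)).toLp,
      (memLp_modulate k (Lp.memLp f)).coeFn_toLp,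
      (memLp_modulate k (Lp.memLp g)).coeFn_toLp, Lp.coeFn_add f g] with γ h1 h2 h3 h4 h5
    rw [h1, h2, Pi.add_apply, h3, h4, h5, Pi.add_apply, mul_add]
  map_smul' c f := by
    refine Lp.ext ?_
    filter_upwards [(memLp_modulate k (Lp.memLp (c • f))).coeFn_toLp,
      Lp.coeFn_smul c (memLp_modulate k (Lp.memLp f)).toLp,
      (memLp_modulate k (Lp.memLp f)).coeFn_toLp, Lp.coeFn_smul c f] with γ h1 h2 h3 h4
    rw [h1, RingHom.id_apply, h2, Pi.smul_apply, h3, h4, Pi.smul_apply, smul_eq_mul, smul_eq_mul,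
      mul_left_comm]
  norm_map' f := by
    change ‖(memLp_modulate k (Lp.memLp f)).toLp‖ = ‖f‖
    rw [Lp.norm_toLp, Lp.norm_def]
    congr 1
    refine eLpNorm_congr_norm_ae (.of_forall fun γ => ?_)
    rw [norm_mul, norm_fourier_coe, one_mul]

theorem modulate_coeFn (k : ℤ) (f : L2R) :
    modulate k f =ᵐ[volume] fun γ => fourier k (γ : UnitAddCircle) * f γ :=
  (memLp_modulate k (Lp.memLp f)).coeFn_toLp

theorem continuous_translate (k : ℤ) : Continuous (translate k) :=
  (Lp.isometry_compMeasurePreserving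
    (measurePreserving_sub_right volume (k : ℝ))).continuous

theorem translate_toLp (k : ℤ) (f : SchwartzMap ℝ ℂ) :
    translate k (f.toLp 2) = (f.compSubConstCLM ℂ (k : ℝ)).toLp 2 := by
  have h0 : ∀ᵐ x : ℝ, f.toLp 2 volume x = f x := f.coeFn_toLp 2 volume
  refine Lp.ext ?_
  filter_upwards [translate_coeFn k (f.toLp 2), (f.compSubConstCLM ℂ (k : ℝ)).coeFn_toLp 2,
    (measurePreserving_sub_right volume (k : ℝ)).quasiMeasurePreserving.ae h0]
    with x h1 h2 h3
  rw [h1, h2, h3, SchwartzMap.compSubConstCLM_apply]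

theorem fourier_compSubConst (k : ℤ) (f : SchwartzMap ℝ ℂ) (γ : ℝ) :
    𝓕 (f.compSubConstCLM ℂ (k : ℝ)) γ = fourier (-k) (γ : UnitAddCircle) * 𝓕 f γ := by
  have h := congrFun (VectorFourier.fourierIntegral_comp_add_right Real.fourierChar volume
    (innerₗ ℝ) f (-(k : ℝ))) γ
  rw [SchwartzMap.fourier_coe, SchwartzMap.fourier_coe, fourier_coe_apply]
  refine h.trans ?_
  rw [Circle.smul_def, Real.fourierChar_apply, smul_eq_mul]
  congr 2
  simp
  ring

/-- Both sides are continuous in `φ`, so it is enough to compare them on Schwartz functions, where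
the Fourier transform is an integral. -/
theorem fourier_translate (k : ℤ) (φ : L2R) :
    𝓕 (translate k φ) = modulate (-k) (𝓕 φ : L2R) := by
  refine DenseRange.induction_on (p := fun φ : L2R => 𝓕 (translate k φ) = modulate (-k) (𝓕 φ : L2R))
    (SchwartzMap.denseRange_toLpCLM (p := 2) ENNReal.ofNat_ne_top) φ ?_ ?_
  · have hF : Continuous fun φ : L2R => (𝓕 φ : L2R) :=
      (Lp.fourierTransformₗᵢ ℝ ℂ).continuous
    exact isClosed_eq (hF.comp (continuous_translate k)) ((modulate (-k)).continuous.comp hF)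
  · intro f
    simp only [SchwartzMap.toLpCLM_apply]
    rw [translate_toLp, SchwartzMap.toLp_fourier_eq, SchwartzMap.toLp_fourier_eq]
    refine Lp.ext ?_
    filter_upwards [(𝓕 (f.compSubConstCLM ℂ (k : ℝ))).coeFn_toLp 2,
      modulate_coeFn (-k) ((𝓕 f).toLp 2), (𝓕 f).coeFn_toLp 2] with γ h1 h2 h3
    rw [h1, h2, h3, fourier_compSubConst]

theorem fourier_translate_coeFn (k : ℤ) (φ : L2R) :
    (𝓕 (translate k φ) : L2R) =ᵐ[volume]
      fun γ => fourier (-k) (γ : UnitAddCircle) * (𝓕 φ : L2R) γ := by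
  rw [fourier_translate]
  exact modulate_coeFn _ _

end FourierTranslate

end ApproxOblique

end
noncomputable section

namespace ApproxOblique

/-! Scalar products and shift-invariant subspaces in terms of the bracket product. -/

section ShiftInvariant

theorem measurable_coeFn (f : L2R) : Measurable f := (Lp.stronglyMeasurable f).measurable

theorem inner_eq_integral_bracketSum (f g : L2R) :
    inner ℂ f g = ∫ γ, bracketSum (𝓕 g : L2R) (𝓕 f : L2R) γ ∂unitVolume := by
  rw [(integrable_bracketSum (Lp.memLp _) (Lp.memLp _)).2, ← Lp.inner_fourier_eq, L2.inner_def]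
  rfl

theorem integral_normSqSum_fourier (f : L2R) :
    ∫ γ, normSqSum (𝓕 f : L2R) γ ∂unitVolume = ‖f‖ ^ 2 := by
  rw [(integrable_normSqSum (Lp.memLp _)).2, ← Lp.norm_fourier_eq f]
  have h := congrArg RCLike.re (L2.inner_def (𝕜 := ℂ) (𝓕 f : L2R) (𝓕 f : L2R))
  rw [← integral_re (L2.integrable_inner _ _)] at h
  simp only [← norm_sq_eq_re_inner] at h
  exact h.symm

/-- The translate contributes the character `-k` on the frequency side. It is periodic, so it leaves
the bracket, and conjugation turns it into the character `k`. -/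
theorem inner_translate (k : ℤ) (φ f : L2R) :
    inner ℂ (translate k φ) f = unitCoeff (bracketSum (𝓕 f : L2R) (𝓕 φ : L2R)) k := by
  rw [inner_eq_integral_bracketSum, unitCoeff]
  refine integral_congr_ae (ae_restrict_of_ae ?_)
  have hm : Function.Periodic (fun γ : ℝ => fourier (-k) (γ : UnitAddCircle)) 1 := fun γ => by
    simp only [AddCircle.coe_add_period]
  filter_upwards [bracketSum_congr (Filter.EventuallyEq.refl _ (𝓕 f : L2R))
    (fourier_translate_coeFn k φ)] with γ h
  rw [h, bracketSum_mul_right hm, ← fourier_neg, neg_neg]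

theorem hasSum_norm_inner_translate_sq {φ f : L2R}
    (h : MemLp (bracketSum (𝓕 f : L2R) (𝓕 φ : L2R)) 2 unitVolume) :
    HasSum (fun k : ℤ => ‖inner ℂ (translate k φ) f‖ ^ 2)
      (∫ γ, ‖bracketSum (𝓕 f : L2R) (𝓕 φ : L2R) γ‖ ^ 2 ∂unitVolume) := by
  simp only [inner_translate]
  exact hasSum_norm_unitCoeff_sq h

/-- A bracket of square-integrable functions is a priori only integrable on `(0, 1]`; the Bessel
property makes its Fourier coefficients square-summable. -/
theorem IsBessel.memLp_bracketSum {φ : L2R} (h : IsBessel fun k : ℤ => translate k φ) (f : L2R) :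
    MemLp (bracketSum (𝓕 f : L2R) (𝓕 φ : L2R)) 2 unitVolume := by
  obtain ⟨β, hβ⟩ := h
  refine memLp_two_of_summable_unitCoeff (integrable_bracketSum (Lp.memLp _) (Lp.memLp _)).1 ?_
  simpa only [inner_translate] using (hβ f).1

theorem inner_analysisOp_translate {φ ψ : L2R} (hφ : IsBessel fun k : ℤ => translate k φ)
    (hψ : IsBessel fun k : ℤ => translate k ψ) (f g : L2R) :
    inner ℂ (analysisOp _ hφ g) (analysisOp _ hψ f) =
      ∫ γ, conj (bracketSum (𝓕 g : L2R) (𝓕 φ : L2R) γ) * bracketSum (𝓕 f : L2R) (𝓕 ψ : L2R) γ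
        ∂unitVolume := by
  rw [lp.inner_eq_tsum,
    ← (hasSum_conj_unitCoeff_mul (hψ.memLp_bracketSum f) (hφ.memLp_bracketSum g)).tsum_eq]
  refine tsum_congr fun k => ?_
  rw [analysisOp_apply, analysisOp_apply, RCLike.inner_apply', inner_translate, inner_translate]

/-- The bracket product of `φ` and `g` vanishes a.e. if `g` is orthogonal to all translates
of `φ`. -/
theorem bracketSum_eq_zero_of_inner_eq_zero {φ g : L2R}
    (h : ∀ k : ℤ, inner ℂ (translate k φ) g = 0) :
    ∀ᵐ γ ∂unitVolume, bracketSum (𝓕 g : L2R) (𝓕 φ : L2R) γ = 0 :=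
  ae_eq_zero_of_unitCoeff_eq_zero (integrable_bracketSum (Lp.memLp _) (Lp.memLp _)).1 fun k => by
    rw [← inner_translate, h]

/-- A closed subspace containing the translates of `η` contains every `θ` with `θ̂ = m η̂` for a
`1`-periodic `m`. -/
theorem mem_of_fourier_eq_mul {W : Submodule ℂ L2R} (hW : IsClosed (W : Set L2R)) {η θ : L2R}
    (hη : ∀ k : ℤ, translate k η ∈ W) {m : ℝ → ℂ} (hm : Function.Periodic m 1)
    (h : (𝓕 θ : L2R) =ᵐ[volume] fun γ => m γ * (𝓕 η : L2R) γ) : θ ∈ W := by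
  have : CompleteSpace W := hW.completeSpace_coe
  rw [← W.orthogonal_orthogonal, Submodule.mem_orthogonal]
  intro g hg
  -- Any `g` orthogonal to `W` has zero bracket with `η`; multiplying by `m` keeps it zero, so `g`
  -- is orthogonal to `θ`, and `W` equals its double orthogonal.
  have h0 := bracketSum_eq_zero_of_inner_eq_zero (φ := η) (g := g) fun k =>
    (Submodule.mem_orthogonal W g).1 hg _ (hη k)
  rw [inner_eq_integral_bracketSum, ← integral_zero ℝ ℂ (μ := unitVolume)]
  refine integral_congr_ae ?_
  filter_upwards [h0, ae_restrict_of_ae (bracketSum_congr h (Filter.EventuallyEq.refl _ (𝓕 g : L2R)))]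
    with γ h1 h2
  rw [h2, bracketSum_mul_left hm, ← conj_bracketSum, h1, map_zero, mul_zero]

/-- Pointwise Cauchy–Schwarz gives `|[f, θ]|² ≤ K [f, f]`; integrating this is the Bessel bound, by
Parseval. -/
theorem translate_bessel_bound_of_normSqSum_le {θ : L2R} {K : ℝ}
    (h : ∀ᵐ γ ∂unitVolume, normSqSum (𝓕 θ : L2R) γ ≤ K) (f : L2R) :
    Summable (fun k : ℤ => ‖inner ℂ (translate k θ) f‖ ^ 2) ∧
      ∑' k : ℤ, ‖inner ℂ (translate k θ) f‖ ^ 2 ≤ K * ‖f‖ ^ 2 := by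
  have hle : ∀ᵐ γ ∂unitVolume, ‖bracketSum (𝓕 f : L2R) (𝓕 θ : L2R) γ‖ ^ 2 ≤
      K * normSqSum (𝓕 f : L2R) γ := by
    filter_upwards [h, ae_restrict_of_ae (norm_bracketSum_le (Lp.memLp (𝓕 f : L2R))
      (Lp.memLp (𝓕 θ : L2R)))] with γ h1 h2
    have hf := normSqSum_nonneg (𝓕 f : L2R) γ
    calc _ ≤ (√(normSqSum (𝓕 f : L2R) γ) * √(normSqSum (𝓕 θ : L2R) γ)) ^ 2 := by gcongr
      _ = normSqSum (𝓕 θ : L2R) γ * normSqSum (𝓕 f : L2R) γ := by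
        rw [mul_pow, Real.sq_sqrt hf, Real.sq_sqrt (normSqSum_nonneg _ _), mul_comm]
      _ ≤ _ := by gcongr
  have hi := (integrable_normSqSum (Lp.memLp (𝓕 f : L2R))).1.const_mul K
  have hm := (integrable_bracketSum (Lp.memLp (𝓕 f : L2R)) (Lp.memLp (𝓕 θ : L2R))).1.1
  have hi2 : Integrable (fun γ => ‖bracketSum (𝓕 f : L2R) (𝓕 θ : L2R) γ‖ ^ 2) unitVolume :=
    hi.mono' (hm.norm.pow 2) (hle.mono fun γ hγ => by simpa using hγ)
  have hs := hasSum_norm_inner_translate_sq ((memLp_two_iff_integrable_sq_norm hm).2 hi2)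
  refine ⟨hs.summable, ?_⟩
  rw [hs.tsum_eq, ← integral_normSqSum_fourier f, ← integral_const_mul]
  exact integral_mono_ae hi2 hi hle

/-- If the translates of `θ` satisfy a lower frame inequality on a closed subspace containing the
translates of `η`, then the bracket product of `η` and `θ` is bounded below. -/
theorem mul_normSqSum_le_norm_bracketSum_sq {W : Submodule ℂ L2R}
    (hW : IsClosed (W : Set L2R)) {η θ : L2R} (hη : ∀ k : ℤ, translate k η ∈ W)
    (hθ : IsBessel fun k : ℤ => translate k θ) {c : ℝ}
    (hc : ∀ f ∈ W, c * ‖f‖ ^ 2 ≤ ∑' k : ℤ, ‖inner ℂ (translate k θ) f‖ ^ 2) :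
    ∀ᵐ γ ∂unitVolume, c * normSqSum (𝓕 η : L2R) γ ≤
      ‖bracketSum (𝓕 η : L2R) (𝓕 θ : L2R) γ‖ ^ 2 := by
  set p := normSqSum (𝓕 η : L2R) with hp
  set q := bracketSum (𝓕 η : L2R) (𝓕 θ : L2R) with hq
  -- `B` is the set where the claim fails. It is periodic, so cutting `η̂` down to `B` gives an
  -- element `f` of `W`; the lower frame inequality for `f` will force `B` to be null in `(0, 1]`.
  let B : Set ℝ := {γ | ‖q γ‖ ^ 2 < c * p γ}
  have hB : MeasurableSet B := measurableSet_lt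
    ((measurable_bracketSum (measurable_coeFn _) (measurable_coeFn _)).norm.pow_const 2)
    ((measurable_normSqSum (measurable_coeFn _)).const_mul c)
  let m : ℝ → ℂ := B.indicator 1
  have hm : Function.Periodic m 1 := fun γ => by
    have : γ + 1 ∈ B ↔ γ ∈ B := by
      simp only [B, mem_ofPred_eq, hp, hq, periodic_normSqSum _ γ, periodic_bracketSum _ _ γ]
    by_cases h : γ ∈ B
    · simp only [m, indicator_of_mem h, indicator_of_mem (this.2 h), Pi.one_apply]
    · simp only [m, indicator_of_notMem h, indicator_of_notMem (mt this.1 h)]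
  have hmem : MemLp (fun γ => m γ * (𝓕 η : L2R) γ) 2 := by
    refine ((Lp.memLp (𝓕 η : L2R)).indicator hB).ae_eq (.of_forall fun γ => ?_)
    by_cases h : γ ∈ B <;> simp [m, h]
  let f : L2R := 𝓕⁻ hmem.toLp
  have hf : (𝓕 f : L2R) =ᵐ[volume] fun γ => m γ * (𝓕 η : L2R) γ := by
    have : (𝓕 f : L2R) = hmem.toLp := FourierTransform.fourier_fourierInv_eq _
    rw [this]
    exact hmem.coeFn_toLp
  have hfW := mem_of_fourier_eq_mul hW hη hm hf
  have hsum := hasSum_norm_inner_translate_sq (hθ.memLp_bracketSum f)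
  have hle := hc f hfW
  have hi1 := (integrable_normSqSum (Lp.memLp (𝓕 f : L2R))).1.const_mul c
  have hi2 := (memLp_two_iff_integrable_sq_norm (hθ.memLp_bracketSum f).1).1
    (hθ.memLp_bracketSum f)
  rw [hsum.tsum_eq, ← integral_normSqSum_fourier, ← integral_const_mul, ← sub_nonpos,
    ← integral_sub hi1 hi2] at hle
  have hD : ∀ᵐ γ ∂unitVolume,
      c * normSqSum (𝓕 f : L2R) γ - ‖bracketSum (𝓕 f : L2R) (𝓕 θ : L2R) γ‖ ^ 2 =
        ‖m γ‖ ^ 2 * (c * p γ - ‖q γ‖ ^ 2) := by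
    filter_upwards [ae_restrict_of_ae (normSqSum_congr hf),
      ae_restrict_of_ae (bracketSum_congr hf (Filter.EventuallyEq.refl _ (𝓕 θ : L2R)))]
      with γ h1 h2
    rw [h1, h2, bracketSum_mul_left hm, normSqSum_mul hm, norm_mul]
    ring
  have hD0 : ∀ γ, 0 ≤ ‖m γ‖ ^ 2 * (c * p γ - ‖q γ‖ ^ 2) := fun γ => by
    by_cases h : γ ∈ B
    · exact mul_nonneg (by positivity) (sub_nonneg.2 (le_of_lt h))
    · simp [m, h]
  rw [integral_congr_ae hD] at hle
  -- The integrand is nonnegative and has nonpositive integral, so it vanishes a.e.; on `B` it is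
  -- strictly positive.
  have h0 := (integral_eq_zero_iff_of_nonneg hD0 ((hi1.sub hi2).congr hD)).1
    (le_antisymm hle (integral_nonneg hD0))
  filter_upwards [h0] with γ hγ
  by_contra hlt
  have hγB : γ ∈ B := not_le.1 hlt
  have : c * p γ - ‖q γ‖ ^ 2 = 0 := by simpa [m, hγB] using hγ
  exact hlt (sub_eq_zero.1 this).le

end ShiftInvariant

end ApproxOblique

end
noncomputable section

namespace ApproxOblique

/-! Frames and oblique projections. -/

section Oblique

variable {ι E : Type*} [NormedAddCommGroup E] [InnerProductSpace ℂ E]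
  {W V : Submodule ℂ E} {F G : ι → E}

theorem norm_analysisOp_sq (hF : IsBessel F) (f : E) :
    ‖analysisOp F hF f‖ ^ 2 = ∑' k, ‖inner ℂ (F k) f‖ ^ 2 := by
  simpa using lp.norm_rpow_eq_tsum (p := 2) (by norm_num) (analysisOp F hF f)

theorem opNorm_le_of_norm_inner_le {T : E →L[ℂ] E} {C : ℝ} (hC : 0 ≤ C)
    (h : ∀ f g, ‖inner ℂ g (T f)‖ ≤ C * ‖f‖ * ‖g‖) : ‖T‖ ≤ C := by
  refine T.opNorm_le_bound hC fun f => ?_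
  have h1 := h f (T f)
  rcases (norm_nonneg (T f)).eq_or_lt with h0 | h0
  · rw [← h0]
    positivity
  · refine le_of_mul_le_mul_right ?_ h0
    simpa [sq] using h1

theorem inner_starProjection_of_mem [CompleteSpace V] {x : E} (hx : x ∈ V) (f : E) :
    inner ℂ x (V.starProjection f) = inner ℂ x f := by
  have h1 := (Submodule.mem_orthogonal V _).1 (V.sub_starProjection_mem_orthogonal f) x hx
  rw [inner_sub_right] at h1
  exact (sub_eq_zero.1 h1).symm

variable [CompleteSpace E]

theorem adjoint_synthesisOp (hF : IsBessel F) :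
    ContinuousLinearMap.adjoint (synthesisOp F hF) = analysisOp F hF :=
  ContinuousLinearMap.adjoint_adjoint _

theorem obliqueProj_eq_of_mem (hW : IsClosed (W : Set E)) (h : IsCompl W Vᗮ) {f q : E}
    (hq : q ∈ W) (hfq : f - q ∈ Vᗮ) : obliqueProj W V hW h f = q := by
  have h1 : obliqueProj W V hW h q = q := Submodule.projectionL_apply_left _ ⟨q, hq⟩
  have h2 : obliqueProj W V hW h (f - q) = 0 := Submodule.projectionL_apply_right _ ⟨_, hfq⟩
  rw [map_sub, h1] at h2
  exact sub_eq_zero.1 h2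

theorem sub_obliqueProj_mem (hW : IsClosed (W : Set E)) (h : IsCompl W Vᗮ) (f : E) :
    f - obliqueProj W V hW h f ∈ Vᗮ := by
  rw [obliqueProj, ← Submodule.projectionL_apply_eq_zero_iff
    (Submodule.IsCompl.isTopCompl_of_isClosed h hW V.isClosed_orthogonal), map_sub]
  exact sub_eq_zero.2
    (Submodule.projectionL_apply_left _ ⟨_, Submodule.projectionL_apply_mem _ _⟩).symm

/-- Since `f - π f` is orthogonal to `f ∈ V`, one has `‖f‖² = ⟨f, π f⟩`, and Cauchy–Schwarz applies.
-/
theorem norm_le_norm_obliqueProj (hW : IsClosed (W : Set E)) (h : IsCompl W Vᗮ) {f : E}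
    (hf : f ∈ V) : ‖f‖ ≤ ‖obliqueProj W V hW h f‖ := by
  have h1 := (Submodule.mem_orthogonal V _).1 (sub_obliqueProj_mem hW h f) f hf
  rw [inner_sub_right, sub_eq_zero] at h1
  have h2 : ‖f‖ ^ 2 = ‖inner ℂ f f‖ := by simp
  have h3 := norm_inner_le_norm (𝕜 := ℂ) f (obliqueProj W V hW h f)
  rw [← h1, ← h2, sq] at h3
  rcases (norm_nonneg f).eq_or_lt with h0 | h0
  · rw [← h0]
    positivity
  · exact le_of_mul_le_mul_left h3 h0

theorem IsFrameFor.mem_orthogonal (hG : IsFrameFor V G) (hV : IsClosed (V : Set E)) {f : E}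
    (hf : ∀ k, inner ℂ (G k) f = 0) : f ∈ Vᗮ := by
  have : CompleteSpace V := hV.completeSpace_coe
  obtain ⟨α, β, hα, -, h⟩ := hG.bounds
  have h1 := (h _ (V.starProjection_apply_mem f)).2.1
  simp only [inner_starProjection_of_mem (hG.mem _), hf] at h1
  have h2 : V.starProjection f = 0 := by
    have h3 : ‖V.starProjection f‖ ^ 2 ≤ 0 := by
      refine nonpos_of_mul_nonpos_right (a := α) ?_ hα
      simpa using h1
    simpa using h3
  simpa [h2] using V.sub_starProjection_mem_orthogonal f

/-- If `E = W ⊕ Vᗮ`, a frame for `V` satisfies a lower frame inequality on `W`. -/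
theorem IsFrameFor.exists_lower_bound (hG : IsFrameFor V G) (hW : IsClosed (W : Set E))
    (hV : IsClosed (V : Set E)) (hWV : IsCompl W Vᗮ) :
    ∃ c : ℝ, 0 < c ∧ ∀ f ∈ W, c * ‖f‖ ^ 2 ≤ ∑' k, ‖inner ℂ (G k) f‖ ^ 2 := by
  have : CompleteSpace V := hV.completeSpace_coe
  obtain ⟨α, β, hα, -, h⟩ := hG.bounds
  set π := obliqueProj W V hW hWV
  refine ⟨α / (‖π‖ ^ 2 + 1), by positivity, fun f hf => ?_⟩
  have h1 := (h _ (V.starProjection_apply_mem f)).2.1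
  simp only [inner_starProjection_of_mem (hG.mem _)] at h1
  refine le_trans ?_ h1
  -- On `W` the orthogonal projection onto `V` is inverted by `π`, hence bounded below; `G` sees
  -- only that projection of `f`.
  have h2 : π (V.starProjection f) = f := by
    refine obliqueProj_eq_of_mem hW hWV hf ?_
    rw [← neg_sub]
    exact Vᗮ.neg_mem (V.sub_starProjection_mem_orthogonal f)
  have h3 : ‖f‖ ≤ ‖π‖ * ‖V.starProjection f‖ := by
    simpa only [h2] using π.le_opNorm (V.starProjection f)
  have h4 : ‖f‖ ^ 2 ≤ (‖π‖ ^ 2 + 1) * ‖V.starProjection f‖ ^ 2 := by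
    calc ‖f‖ ^ 2 ≤ (‖π‖ * ‖V.starProjection f‖) ^ 2 := by gcongr
      _ ≤ _ := by
        rw [mul_pow]
        gcongr
        linarith
  rw [div_mul_eq_mul_div, div_le_iff₀ (by positivity)]
  calc α * ‖f‖ ^ 2 ≤ α * ((‖π‖ ^ 2 + 1) * ‖V.starProjection f‖ ^ 2) := by gcongr
    _ = _ := by ring

/-- A Bessel sequence in `V` whose mixed frame operator is within `ε < 1` of the oblique
projection is a frame for `V`. -/
theorem isFrameFor_of_norm_obliqueProj_sub_le (hW : IsClosed (W : Set E)) (hWV : IsCompl W Vᗮ)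
    (hF : IsBessel F) (hG : IsBessel G) (hGV : ∀ k, G k ∈ V) {ε : ℝ} (hε : ε < 1)
    (h : ‖obliqueProj W V hW hWV -
      synthesisOp F hF ∘L ContinuousLinearMap.adjoint (synthesisOp G hG)‖ ≤ ε) :
    IsFrameFor V G := by
  obtain ⟨β, hβ⟩ := id hG
  set S := synthesisOp F hF
  have hpos : 0 < (1 - ε) / (‖S‖ + 1) := div_pos (sub_pos.2 hε) (by positivity)
  -- The lower bound comes from `(1 - ε) ‖f‖ ≤ ‖S (analysisOp G hG f)‖ ≤ ‖S‖ ‖analysisOp G hG f‖`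
  -- for `f ∈ V`; the `+ 1` avoids division by zero, and the maximum secures the order of the two
  -- frame bounds.
  refine ⟨hGV, ((1 - ε) / (‖S‖ + 1)) ^ 2, max β (((1 - ε) / (‖S‖ + 1)) ^ 2), by positivity,
    le_max_right _ _, fun f hf => ⟨(hβ f).1, ?_, (hβ f).2.trans ?_⟩⟩
  · rw [← norm_analysisOp_sq hG, ← mul_pow]
    gcongr
    rw [div_mul_eq_mul_div, div_le_iff₀ (by positivity)]
    have h1 := norm_le_norm_obliqueProj hW hWV hf
    have h2 := ContinuousLinearMap.le_of_opNorm_le _ h f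
    rw [adjoint_synthesisOp, sub_apply, ContinuousLinearMap.comp_apply] at h2
    have h3 := norm_le_norm_add_norm_sub' (obliqueProj W V hW hWV f) (S (analysisOp G hG f))
    have h4 := S.le_opNorm (analysisOp G hG f)
    nlinarith [norm_nonneg (analysisOp G hG f)]
  · gcongr
    exact le_max_left _ _

end Oblique

end ApproxOblique

end
noncomputable section

namespace ApproxOblique

/-! Mixed frame operators of shift-invariant systems. -/

section MixedFrameOperator

theorem integral_sqrt_normSqSum_mul_le (f g : L2R) :
    Integrable (fun γ => √(normSqSum (𝓕 f : L2R) γ) * √(normSqSum (𝓕 g : L2R) γ)) unitVolume ∧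
      ∫ γ, √(normSqSum (𝓕 f : L2R) γ) * √(normSqSum (𝓕 g : L2R) γ) ∂unitVolume ≤ ‖f‖ * ‖g‖ := by
  have hsq : ∀ f : L2R, ∀ γ, √(normSqSum (𝓕 f : L2R) γ) ^ 2 = normSqSum (𝓕 f : L2R) γ :=
    fun f γ => Real.sq_sqrt (normSqSum_nonneg _ _)
  have hL : ∀ f : L2R, MemLp (fun γ => √(normSqSum (𝓕 f : L2R) γ)) 2 unitVolume := fun f => by
    rw [memLp_two_iff_integrable_sq
      (measurable_normSqSum (measurable_coeFn _)).sqrt.aestronglyMeasurable]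
    simp only [hsq]
    exact (integrable_normSqSum (Lp.memLp _)).1
  refine ⟨(hL f).integrable_mul (hL g), ?_⟩
  have h := integral_mul_le_Lp_mul_Lq_of_nonneg (μ := unitVolume) Real.HolderConjugate.two_two
    (.of_forall fun γ => Real.sqrt_nonneg (normSqSum (𝓕 f : L2R) γ))
    (.of_forall fun γ => Real.sqrt_nonneg (normSqSum (𝓕 g : L2R) γ))
    (by simpa using hL f) (by simpa using hL g)
  simpa only [Real.rpow_ofNat, hsq, integral_normSqSum_fourier, ← Real.sqrt_eq_rpow,
    Real.sqrt_sq (norm_nonneg _)] using h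

variable {W V : Submodule ℂ L2R} {φ φ₁ : L2R}

/-- The oblique projection of `f` has Fourier transform `([f, φ₁] / [φ, φ₁]) φ̂`; this is its weak
form, tested against `g`. -/
theorem inner_obliqueProj (hW : IsClosed (W : Set L2R)) (hV : IsClosed (V : Set L2R))
    (hWV : IsCompl W Vᗮ) (hφ : ∀ k : ℤ, translate k φ ∈ W)
    (hφ₁ : IsFrameFor V fun k : ℤ => translate k φ₁) {c : ℝ} (hc : 0 < c)
    (h₀ : ∀ᵐ γ ∂unitVolume, c * normSqSum (𝓕 φ : L2R) γ ≤
      ‖bracketSum (𝓕 φ : L2R) (𝓕 φ₁ : L2R) γ‖ ^ 2)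
    (h₁ : ∀ᵐ γ ∂unitVolume, c * normSqSum (𝓕 φ₁ : L2R) γ ≤
      ‖bracketSum (𝓕 φ : L2R) (𝓕 φ₁ : L2R) γ‖ ^ 2) (f g : L2R) :
    Integrable (fun γ => bracketSum (𝓕 f : L2R) (𝓕 φ₁ : L2R) γ /
        bracketSum (𝓕 φ : L2R) (𝓕 φ₁ : L2R) γ * conj (bracketSum (𝓕 g : L2R) (𝓕 φ : L2R) γ))
        unitVolume ∧
      inner ℂ g (obliqueProj W V hW hWV f) =
        ∫ γ, bracketSum (𝓕 f : L2R) (𝓕 φ₁ : L2R) γ / bracketSum (𝓕 φ : L2R) (𝓕 φ₁ : L2R) γ *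
          conj (bracketSum (𝓕 g : L2R) (𝓕 φ : L2R) γ) ∂unitVolume := by
  set A := bracketSum (𝓕 f : L2R) (𝓕 φ₁ : L2R)
  set B := bracketSum (𝓕 φ : L2R) (𝓕 φ₁ : L2R)
  let m : ℝ → ℂ := fun γ => A γ / B γ
  have hm : Function.Periodic m 1 := (periodic_bracketSum _ _).div (periodic_bracketSum _ _)
  have hA : MemLp A 2 unitVolume := (hφ₁.isBessel hV).memLp_bracketSum f
  have hmm : Measurable m := (measurable_bracketSum (measurable_coeFn _) (measurable_coeFn _)).div
    (measurable_bracketSum (measurable_coeFn _) (measurable_coeFn _))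
  have hmφ : Measurable fun γ => m γ * (𝓕 φ : L2R) γ := hmm.mul (measurable_coeFn _)
  -- By `h₀`, `|m|² Φ ≤ |A|² / c`, which is integrable; where `B` vanishes, so does `m`.
  have hmem : MemLp (fun γ => m γ * (𝓕 φ : L2R) γ) 2 := by
    refine memLp_periodic_mul hm hmm (Lp.memLp _) ?_
    refine ((hA.integrable_norm_pow (p := 2) two_ne_zero).const_mul c⁻¹).mono'
      ((hmm.norm.pow_const 2).mul
        (measurable_normSqSum (measurable_coeFn _))).aestronglyMeasurable ?_
    filter_upwards [h₀] with γ hγ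
    rw [Real.norm_of_nonneg (mul_nonneg (by positivity) (normSqSum_nonneg _ _)), norm_div, div_pow]
    by_cases hB : B γ = 0
    · have : ‖A γ‖ ^ 2 / ‖B γ‖ ^ 2 * normSqSum (𝓕 φ : L2R) γ = 0 := by simp [hB]
      rw [this]
      positivity
    · have hB' : 0 < ‖B γ‖ ^ 2 := by positivity
      rw [div_mul_eq_mul_div, div_le_iff₀ hB', mul_assoc, mul_left_comm]
      gcongr
      rwa [inv_mul_eq_div, le_div_iff₀ hc, mul_comm]
  let q : L2R := 𝓕⁻ hmem.toLp
  have hq : (𝓕 q : L2R) =ᵐ[volume] fun γ => m γ * (𝓕 φ : L2R) γ := by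
    have : (𝓕 q : L2R) = hmem.toLp := FourierTransform.fourier_fourierInv_eq _
    rw [this]
    exact hmem.coeFn_toLp
  have hqW : q ∈ W := mem_of_fourier_eq_mul hW hφ hm hq
  have hsub : (𝓕 (f - q) : L2R) =ᵐ[volume] fun γ => (𝓕 f : L2R) γ - (𝓕 q : L2R) γ := by
    have : (𝓕 (f - q) : L2R) = 𝓕 f - 𝓕 q := map_sub (Lp.fourierTransformₗᵢ ℝ ℂ) f q
    rw [this]
    exact Lp.coeFn_sub _ _
  have hfq : f - q ∈ Vᗮ := by
    refine hφ₁.mem_orthogonal hV fun k => ?_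
    have h : bracketSum (𝓕 (f - q) : L2R) (𝓕 φ₁ : L2R) =ᵐ[unitVolume] 0 := by
      filter_upwards [ae_restrict_of_ae (bracketSum_congr hsub
          (Filter.EventuallyEq.refl _ (𝓕 φ₁ : L2R))),
        ae_restrict_of_ae (bracketSum_sub_left (Lp.memLp (𝓕 f : L2R)) (Lp.memLp (𝓕 q : L2R))
          (Lp.memLp (𝓕 φ₁ : L2R))),
        ae_restrict_of_ae (bracketSum_congr hq (Filter.EventuallyEq.refl _ (𝓕 φ₁ : L2R))),
        ae_restrict_of_ae (norm_bracketSum_le (Lp.memLp (𝓕 f : L2R)) (Lp.memLp (𝓕 φ₁ : L2R))),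
        h₁] with γ e1 e2 e3 e4 e5
      rw [e1, e2, e3, bracketSum_mul_left hm, Pi.zero_apply, sub_eq_zero]
      change A γ = A γ / B γ * B γ
      -- Where `B` vanishes, `h₁` forces `Φ₁ = 0`, hence `A = 0`, and the convention `A / 0 = 0`
      -- does no harm.
      by_cases hB : B γ = 0
      · have : normSqSum (𝓕 φ₁ : L2R) γ = 0 := by
          refine le_antisymm ?_ (normSqSum_nonneg _ _)
          refine nonpos_of_mul_nonpos_right (a := c) ?_ hc
          simpa [B, hB] using e5
        have hA0 : A γ = 0 := by simpa [A, this] using e4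
        rw [hA0, zero_div, zero_mul]
      · rw [div_mul_cancel₀ _ hB]
    rw [inner_translate, unitCoeff_congr h]
    simp [unitCoeff]
  rw [obliqueProj_eq_of_mem hW hWV hqW hfq, inner_eq_integral_bracketSum]
  have he : bracketSum (𝓕 q : L2R) (𝓕 g : L2R) =ᵐ[unitVolume] fun γ =>
      A γ / B γ * conj (bracketSum (𝓕 g : L2R) (𝓕 φ : L2R) γ) := by
    filter_upwards [ae_restrict_of_ae (bracketSum_congr hq
      (Filter.EventuallyEq.refl _ (𝓕 g : L2R)))] with γ h
    rw [h, bracketSum_mul_left hm, conj_bracketSum]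
  exact ⟨(integrable_bracketSum (Lp.memLp _) (Lp.memLp _)).1.congr he, integral_congr_ae he⟩

/-- The frame for `V` has a lower bound on `W` and, since the decomposition is symmetric, the frame
for `W` has one on `V`. Each gives one of the two inequalities. -/
theorem exists_mul_normSqSum_le (hW : IsClosed (W : Set L2R)) (hV : IsClosed (V : Set L2R))
    (hWV : IsCompl W Vᗮ) (hφ : IsFrameFor W fun k : ℤ => translate k φ)
    (hφ₁ : IsFrameFor V fun k : ℤ => translate k φ₁) :
    ∃ c : ℝ, 0 < c ∧
      (∀ᵐ γ ∂unitVolume, c * normSqSum (𝓕 φ : L2R) γ ≤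
        ‖bracketSum (𝓕 φ : L2R) (𝓕 φ₁ : L2R) γ‖ ^ 2) ∧
      ∀ᵐ γ ∂unitVolume, c * normSqSum (𝓕 φ₁ : L2R) γ ≤
        ‖bracketSum (𝓕 φ : L2R) (𝓕 φ₁ : L2R) γ‖ ^ 2 := by
  obtain ⟨c₀, hc₀, hl₀⟩ := hφ₁.exists_lower_bound hW hV hWV
  obtain ⟨c₁, hc₁, hl₁⟩ := hφ.exists_lower_bound hV hW (isCompl_swap hW hV hWV)
  refine ⟨min c₀ c₁, lt_min hc₀ hc₁, ?_, ?_⟩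
  · filter_upwards [mul_normSqSum_le_norm_bracketSum_sq hW hφ.mem (hφ₁.isBessel hV) hl₀] with γ h
    exact (mul_le_mul_of_nonneg_right (min_le_left _ _) (normSqSum_nonneg _ _)).trans h
  · filter_upwards [mul_normSqSum_le_norm_bracketSum_sq hV hφ₁.mem (hφ.isBessel hW) hl₁] with γ h
    rw [← conj_bracketSum, RCLike.norm_conj] at h
    exact (mul_le_mul_of_nonneg_right (min_le_right _ _) (normSqSum_nonneg _ _)).trans h

/-- If the multiplier `H` is within `ε / √(Φ Φ₁)` of the reciprocal of the bracket product, then the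
mixed frame operator is within `ε` of the oblique projection. -/
theorem norm_obliqueProj_sub_le (hW : IsClosed (W : Set L2R)) (hV : IsClosed (V : Set L2R))
    (hWV : IsCompl W Vᗮ) (hφ : IsFrameFor W fun k : ℤ => translate k φ)
    (hφ₁ : IsFrameFor V fun k : ℤ => translate k φ₁) {c : ℝ} (hc : 0 < c)
    (h₀ : ∀ᵐ γ ∂unitVolume, c * normSqSum (𝓕 φ : L2R) γ ≤
      ‖bracketSum (𝓕 φ : L2R) (𝓕 φ₁ : L2R) γ‖ ^ 2)
    (h₁ : ∀ᵐ γ ∂unitVolume, c * normSqSum (𝓕 φ₁ : L2R) γ ≤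
      ‖bracketSum (𝓕 φ : L2R) (𝓕 φ₁ : L2R) γ‖ ^ 2)
    {ψ : L2R} (hψB : IsBessel fun k : ℤ => translate k ψ) {H : ℝ → ℂ}
    (hHper : Function.Periodic H 1)
    (hψ : (𝓕 ψ : L2R) =ᵐ[volume] fun γ => H γ * (𝓕 φ₁ : L2R) γ) {ε : ℝ} (hε : 0 ≤ ε)
    (hH : ∀ᵐ γ ∂unitVolume, normSqSum (𝓕 φ : L2R) γ ≠ 0 →
      ‖conj (H γ) - 1 / bracketSum (𝓕 φ : L2R) (𝓕 φ₁ : L2R) γ‖ ≤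
        ε / √(normSqSum (𝓕 φ : L2R) γ * normSqSum (𝓕 φ₁ : L2R) γ)) :
    ‖obliqueProj W V hW hWV - synthesisOp _ (hφ.isBessel hW) ∘L
      ContinuousLinearMap.adjoint (synthesisOp _ hψB)‖ ≤ ε := by
  refine opNorm_le_of_norm_inner_le hε fun f g => ?_
  rw [sub_apply, ContinuousLinearMap.comp_apply, adjoint_synthesisOp, inner_sub_right, synthesisOp,
    ContinuousLinearMap.adjoint_inner_right, inner_analysisOp_translate]
  obtain ⟨hi, he⟩ := inner_obliqueProj hW hV hWV hφ.mem hφ₁ hc h₀ h₁ f g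
  have hi2 : Integrable (fun γ => conj (bracketSum (𝓕 g : L2R) (𝓕 φ : L2R) γ) *
      bracketSum (𝓕 f : L2R) (𝓕 ψ : L2R) γ) unitVolume :=
    ((hφ.isBessel hW).memLp_bracketSum g).star.integrable_mul (hψB.memLp_bracketSum f)
  obtain ⟨hi3, hle⟩ := integral_sqrt_normSqSum_mul_le f g
  rw [he, ← integral_sub hi hi2, mul_assoc]
  refine (norm_integral_le_of_norm_le (hi3.const_mul ε) ?_).trans
    ((integral_const_mul _ _).trans_le (mul_le_mul_of_nonneg_left hle hε))
  filter_upwards [hH, h₀,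
    ae_restrict_of_ae (norm_bracketSum_le (Lp.memLp (𝓕 f : L2R)) (Lp.memLp (𝓕 φ₁ : L2R))),
    ae_restrict_of_ae (norm_bracketSum_le (Lp.memLp (𝓕 g : L2R)) (Lp.memLp (𝓕 φ : L2R))),
    ae_restrict_of_ae (norm_bracketSum_le (Lp.memLp (𝓕 φ : L2R)) (Lp.memLp (𝓕 φ₁ : L2R))),
    ae_restrict_of_ae (bracketSum_congr (Filter.EventuallyEq.refl _ (𝓕 f : L2R)) hψ)]
    with γ e1 e2 e4 e5 e6 e7
  rw [e7, bracketSum_mul_right hHper]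
  set A := bracketSum (𝓕 f : L2R) (𝓕 φ₁ : L2R) γ
  set B := bracketSum (𝓕 φ : L2R) (𝓕 φ₁ : L2R) γ
  set D := bracketSum (𝓕 g : L2R) (𝓕 φ : L2R) γ
  have hP := normSqSum_nonneg (𝓕 φ : L2R) γ
  have hQ := normSqSum_nonneg (𝓕 φ₁ : L2R) γ
  set P := normSqSum (𝓕 φ : L2R) γ
  set Q := normSqSum (𝓕 φ₁ : L2R) γ
  have hs : ‖A / B * conj D - conj D * (conj (H γ) * A)‖ = ‖A‖ * ‖conj (H γ) - 1 / B‖ * ‖D‖ := by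
    rw [← RCLike.norm_conj D, ← norm_mul, ← norm_mul, ← norm_neg]
    congr 1
    ring
  rw [hs]
  -- Where `Φ = 0` the hypothesis on `H` is silent, but there `[g, φ]` vanishes too. Elsewhere `[φ,
  -- φ₁] ≠ 0`, so `Φ₁ > 0` and the square roots cancel.
  rcases hP.eq_or_lt' with hP0 | hP0
  · have hD : ‖D‖ = 0 := by
      refine le_antisymm ?_ (norm_nonneg _)
      simpa [hP0] using e5
    rw [hD, mul_zero]
    positivity
  · have hB : 0 < ‖B‖ ^ 2 := (mul_pos hc hP0).trans_le e2
    have hQ0 : 0 < Q := by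
      refine hQ.lt_of_ne' fun h => ?_
      have : ‖B‖ = 0 := le_antisymm (by simpa [h] using e6) (norm_nonneg _)
      simp [this] at hB
    have hsP : 0 < √P := Real.sqrt_pos.2 hP0
    have hsQ : 0 < √Q := Real.sqrt_pos.2 hQ0
    have e1' := e1 hP0.ne'
    rw [Real.sqrt_mul hP] at e1'
    calc ‖A‖ * ‖conj (H γ) - 1 / B‖ * ‖D‖
        ≤ (√(normSqSum (𝓕 f : L2R) γ) * √Q) * (ε / (√P * √Q)) *
          (√(normSqSum (𝓕 g : L2R) γ) * √P) := by gcongr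
      _ = _ := by field_simp

/-- A multiplier within `ε / √(Φ Φ₁)` of the reciprocal of a bracket product bounded below yields
a bounded periodization. -/
theorem normSqSum_le_of_norm_conj_sub_le {c ε P Q : ℝ} {B h : ℂ} (hc : 0 < c)
    (hP : 0 ≤ P) (hQ : 0 ≤ Q) (h₁ : c * Q ≤ ‖B‖ ^ 2)
    (hB : ‖B‖ ≤ √P * √Q) (hh : P ≠ 0 → ‖conj h - 1 / B‖ ≤ ε / √(P * Q)) :
    ‖h‖ ^ 2 * Q ≤ 2 * (1 + ε ^ 2) / c := by
  have hB2 : ‖B‖ ^ 2 ≤ P * Q := by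
    calc ‖B‖ ^ 2 ≤ (√P * √Q) ^ 2 := by gcongr
      _ = P * Q := by rw [mul_pow, Real.sq_sqrt hP, Real.sq_sqrt hQ]
  rcases hQ.eq_or_lt' with hQ0 | hQ0
  · rw [hQ0, mul_zero]
    positivity
  have hBpos : 0 < ‖B‖ ^ 2 := (mul_pos hc hQ0).trans_le h₁
  -- Comparing `c Q ≤ |B|² ≤ P Q` bounds `P` away from zero wherever `Q > 0`, which controls `ε² /
  -- P` below.
  have hcP : c ≤ P := le_of_mul_le_mul_right (h₁.trans hB2) hQ0
  have hP0 : 0 < P := hc.trans_le hcP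
  have h1 : ‖h‖ ≤ ‖conj h - 1 / B‖ + ‖1 / B‖ := by
    rw [← RCLike.norm_conj h]
    simpa using norm_add_le (conj h - 1 / B) (1 / B)
  have h2 : ‖conj h - 1 / B‖ ^ 2 ≤ ε ^ 2 / (P * Q) := by
    calc _ ≤ (ε / √(P * Q)) ^ 2 := by gcongr; exact hh hP0.ne'
      _ = _ := by rw [div_pow, Real.sq_sqrt (by positivity)]
  have h3 : ‖1 / B‖ ^ 2 = 1 / ‖B‖ ^ 2 := by rw [norm_div, norm_one, div_pow, one_pow]
  have h4 : ‖h‖ ^ 2 ≤ 2 * (ε ^ 2 / (P * Q) + 1 / ‖B‖ ^ 2) := by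
    calc ‖h‖ ^ 2 ≤ (‖conj h - 1 / B‖ + ‖1 / B‖) ^ 2 := by gcongr
      _ ≤ 2 * (‖conj h - 1 / B‖ ^ 2 + ‖1 / B‖ ^ 2) := add_sq_le
      _ ≤ _ := by rw [h3]; gcongr
  calc ‖h‖ ^ 2 * Q ≤ 2 * (ε ^ 2 / (P * Q) + 1 / ‖B‖ ^ 2) * Q := by gcongr
    _ = 2 * (ε ^ 2 / P + Q / ‖B‖ ^ 2) := by field_simp
    _ ≤ 2 * (ε ^ 2 / c + 1 / c) := by
      gcongr 2 * (ε ^ 2 / ?_ + ?_)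
      rw [div_le_div_iff₀ hBpos hc]
      linarith
    _ = _ := by ring

end MixedFrameOperator

end ApproxOblique

end

theorem mainTheorem3
    (W V : Submodule ℂ ApproxOblique.L2R)
    (hW : IsClosed (W : Set ApproxOblique.L2R)) (hV : IsClosed (V : Set ApproxOblique.L2R))
    (hWV : IsCompl W Vᗮ)
    (φ φ₁ : ApproxOblique.L2R)
    (hφ : ApproxOblique.IsFrameFor W (fun k : ℤ => ApproxOblique.translate k φ))
    (hφ₁ : ApproxOblique.IsFrameFor V (fun k : ℤ => ApproxOblique.translate k φ₁))
    (ε : ℝ) (hε₀ : 0 ≤ ε) (hε₁ : ε < 1)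
    (ψ : ApproxOblique.L2R) (hψV : ψ ∈ V)
    (H : ℝ → ℂ) (hHper : Function.Periodic H 1)
    (hHL2 : MemLp H 2 (volume.restrict (Ioo (0 : ℝ) 1)))
    (hψ : (𝓕 ψ : ApproxOblique.L2R) =ᵐ[volume]
      fun γ => H γ * (𝓕 φ₁ : ApproxOblique.L2R) γ)
    (hH : ∀ᵐ γ ∂(volume.restrict (Icc (0 : ℝ) 1)),
      ApproxOblique.periodization φ γ ≠ 0 →
        ‖conj (H γ) - 1 / ApproxOblique.bracket φ φ₁ γ‖ ≤
          ε / Real.sqrt (ApproxOblique.periodization φ γ *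
            ApproxOblique.periodization φ₁ γ)) :
    ApproxOblique.IsApproxObliqueDual ε W V hW hV hWV
      (fun k : ℤ => ApproxOblique.translate k φ)
      (fun k : ℤ => ApproxOblique.translate k ψ) := by
  open ApproxOblique in
  obtain ⟨c, hc, hP, hQ⟩ := exists_mul_normSqSum_le hW hV hWV hφ hφ₁
  have hH' : ∀ᵐ γ ∂unitVolume, normSqSum (𝓕 φ : L2R) γ ≠ 0 →
      ‖conj (H γ) - 1 / bracketSum (𝓕 φ : L2R) (𝓕 φ₁ : L2R) γ‖ ≤
        ε / √(normSqSum (𝓕 φ : L2R) γ * normSqSum (𝓕 φ₁ : L2R) γ) := by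
    rw [unitVolume, Measure.restrict_congr_set Ioc_ae_eq_Icc]
    exact hH
  -- The Bessel property of the translates of `ψ` must come first: without it their synthesis
  -- operator is not defined.
  have hbound : ∀ᵐ γ ∂unitVolume, normSqSum (𝓕 ψ : L2R) γ ≤ 2 * (1 + ε ^ 2) / c := by
    filter_upwards [hH', hQ, ae_restrict_of_ae (normSqSum_congr hψ),
      ae_restrict_of_ae (norm_bracketSum_le (Lp.memLp (𝓕 φ : L2R)) (Lp.memLp (𝓕 φ₁ : L2R)))]
      with γ h1 h3 h4 h5
    rw [h4, normSqSum_mul hHper]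
    exact normSqSum_le_of_norm_conj_sub_le hc (normSqSum_nonneg _ _) (normSqSum_nonneg _ _)
      h3 h5 h1
  have hψB : IsBessel fun k : ℤ => translate k ψ := ⟨_, translate_bessel_bound_of_normSqSum_le hbound⟩
  have hmem : ∀ k : ℤ, translate k ψ ∈ V := fun k => by
    refine mem_of_fourier_eq_mul hV hφ₁.mem
      (m := fun γ => fourier (-k) (γ : UnitAddCircle) * H γ) (fun γ => ?_) ?_
    · simp only [AddCircle.coe_add_period, hHper γ]
    · filter_upwards [fourier_translate_coeFn k ψ, hψ] with γ h1 h2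
      rw [h1, h2, mul_assoc]
  have hnorm := norm_obliqueProj_sub_le hW hV hWV hφ hφ₁ hc hP hQ hψB hHper hψ hε₀ hH'
  exact ⟨hφ, isFrameFor_of_norm_obliqueProj_sub_le hW hWV (hφ.isBessel hW) hψB hmem hε₁ hnorm,
    Or.inl hnorm⟩
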